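/- Let $s=(s_m)_{m\ge 1}$ be a sequence of positive integers with $s_m\mid s_{m+1}$ and $s_m<s_{m+1}$, put $s_0:=1$, and let $\mathbb Z_S=\varprojlim \mathbb Z/s_m\mathbb Z$, a compact totally disconnected ring containing $\mathbb Z$. For an integer $x\ge 1$ let $n(x)\ge 1$ be the integer with $s_{n(x)-1}\le x<s_{n(x)}$ and put $\gamma(x):=x \bmod s_{n(x)-1}\in\{0,\dots,s_{n(x)-1}-1\}$; put $n(0):=0$. For $x\ge 0$ let $1_{(x)}\in C(\mathbb Z_S,\mathbb Z)$ be the characteristic function of $\{z: s_{n(x)}\mid z-x\}$. There is no $\gamma(0)$; by convention $f(\gamma(0)):=0$ for every function $f$ on $\mathbb Z_S$. Let $\Phi\in\mathrm{Hom}(C(\mathbb Z_S,\mathbb Z),\mathbb Z)$ and $\phi_{(y)}:=\Phi(1_{(y)})$ for $y\ge 0$. Let $H_{ev}$ and $H_{odd}$ be Hilbert spaces with orthonormal bases $E^{ev,\pm}_{(y,j)}$ and $E^{odd,\pm}_{(y,j)}$, indexed by the pairs $(y,j)$ with $\phi_{(y)}\neq 0$ and $1\le j\le|\phi_{(y)}|$,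 the sign $\pm$ being the sign of $\phi_{(y)}$. Define $*$-representations of $C(\mathbb Z_S)$ by $$\rho_{ev}(f)E^{ev,+}_{(y,j)}=f(\gamma(y))E^{ev,+}_{(y,j)},\quad \rho_{ev}(f)E^{ev,-}_{(y,j)}=f(y)E^{ev,-}_{(y,j)},$$ $$\rho_{odd}(f)E^{odd,+}_{(y,j)}=f(y)E^{odd,+}_{(y,j)},\quad \rho_{odd}(f)E^{odd,-}_{(y,j)}=f(\gamma(y))E^{odd,-}_{(y,j)},$$ let $G:H_{odd}\to H_{ev}$ be the unitary with $GE^{odd,\pm}_{(y,j)}=E^{ev,\pm}_{(y,j)}$, and let $F=\begin{bmatrix}0&G\\G^*&0\end{bmatrix}$ on $H=H_{ev}\oplus H_{odd}$, graded by $\Gamma=1\oplus(-1)$. Then $(H_{ev}\oplus H_{odd},\rho_{ev}\oplus\rho_{odd},F)$ is an even Fredholm module over $C(\mathbb Z_S)$: with $\rho=\rho_{ev}\oplus\rho_{odd}$, the operators $F^*-F$, $I-F^2$ and $[F,\rho(f)]$ are compact for all $f\in C(\mathbb Z_S)$, and $\Gamma^*=\Gamma$, $\Gamma^2=I$, $\Gamma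 F=-F\Gamma$, $\Gamma\rho(f)=\rho(f)\Gamma$. Its index pairing with $K_0(C(\mathbb Z_S))$ is $\Phi$ under the canonical identification $K_0(C(\mathbb Z_S))\cong C(\mathbb Z_S,\mathbb Z)$, $[p]_0\mapsto(z\mapsto\operatorname{rank}p(z))$; that is, for every $n$ and every projection $p\in M_n(C(\mathbb Z_S))$ the operator $$\rho_{ev}(p)(G\otimes 1_n)\rho_{odd}(p):\operatorname{Ran}\rho_{odd}(p)\to\operatorname{Ran}\rho_{ev}(p)$$ is Fredholm, and its index is $\Phi(z\mapsto\operatorname{rank}p(z))$. -/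

import Mathlib

open scoped ENNReal Matrix lp

noncomputable section

namespace Odometer

/-! ### The odometer `ℤ_S` of a scale -/

/-- A scale `1 = s₀, s₁ < s₂ < ⋯` of positive integers with `s_m ∣ s_{m+1}`. -/
structure Scale where
  /-- the terms of the scale -/
  s : ℕ → ℕ
  s_zero : s 0 = 1
  pos : ∀ m, 0 < s m
  dvd : ∀ m, s m ∣ s (m + 1)
  lt : ∀ m, 1 ≤ m → s m < s (m + 1)

variable (S : Scale)

/-- The inverse limit of the rings `ℤ / s_m ℤ` (the index `m = 0` adds only the trivial
factor `ℤ / 1`), with the subspace topology of the product of discrete spaces. -/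
def ZS : Subring (∀ m, ZMod (S.s m)) where
  carrier := {x | ∀ m, ZMod.castHom (S.dvd m) (ZMod (S.s m)) (x (m + 1)) = x m}
  mul_mem' {a b} ha hb m := by
    simp only [Set.mem_ofPred_eq] at ha hb
    rw [Pi.mul_apply, map_mul, ha, hb, Pi.mul_apply]
  one_mem' m := by rw [Pi.one_apply, map_one, Pi.one_apply]
  add_mem' {a b} ha hb m := by
    simp only [Set.mem_ofPred_eq] at ha hb
    rw [Pi.add_apply, map_add, ha, hb, Pi.add_apply]
  zero_mem' m := by simp
  neg_mem' {a} ha m := by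
    simp only [Set.mem_ofPred_eq] at ha
    rw [Pi.neg_apply, map_neg, ha, Pi.neg_apply]

instance : CompactSpace (ZS S) := by
  have : ∀ m, NeZero (S.s m) := fun m => ⟨(S.pos m).ne'⟩
  refine isCompact_iff_compactSpace.mp (IsClosed.isCompact ?_)
  have h : ((ZS S : Subring _) : Set (∀ m, ZMod (S.s m))) =
      ⋂ m, {x | ZMod.castHom (S.dvd m) (ZMod (S.s m)) (x (m + 1)) = x m} := by
    ext x; simp [ZS]
  rw [h]
  exact isClosed_iInter fun m =>
    isClosed_eq (continuous_of_discreteTopology.comp (continuous_apply _)) (continuous_apply _)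

/-- The characteristic function `1_{(n,x)}` of `{z : s_n ∣ z - x}`; an element of the inverse
limit is divisible by `s_n` exactly when its component in `ℤ / s_n ℤ` vanishes. -/
def indicatorAt (n x : ℕ) : C(ZS S, ℤ) where
  toFun z := if z.1 n = (x : ZMod (S.s n)) then 1 else 0
  continuous_toFun :=
    (continuous_of_discreteTopology
      (f := fun t : ZMod (S.s n) => if t = (x : ZMod (S.s n)) then (1 : ℤ) else 0)).comp
      ((continuous_apply n).comp continuous_subtype_val)

theorem Scale.exists_lt (x : ℕ) : ∃ n, x < S.s n := by
  have h : ∀ n, n < S.s (n + 1) := by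
    intro n
    induction n with
    | zero => exact S.pos 1
    | succ k ih => exact lt_of_le_of_lt ih (S.lt (k + 1) (by omega))
  exact ⟨x + 1, h x⟩

/-- The level `n(x)`: the least `n` with `x < s_n`, so that `n(0) = 0` and
`s_{n(x)-1} ≤ x < s_{n(x)}` for `x ≥ 1`. -/
def Scale.level (x : ℕ) : ℕ := Nat.find (S.exists_lt x)

/-- The free generators `1_{(x)} = 1_{(n(x),x)}` of `C(ℤ_S, ℤ)`. -/
def generator (x : ℕ) : C(ZS S, ℤ) := indicatorAt S (S.level x) x

/-- The predecessor `γ(x) = x mod s_{n(x)-1}`, for `x ≥ 1`; there is no `γ(0)`. -/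
def Scale.gam (x : ℕ) : Option ℕ :=
  if x = 0 then none else some (x % S.s (S.level x - 1))

/-! ### Even Fredholm modules -/

section Fredholm

variable {A : Type*} [CStarAlgebra A]

/-- `(H, ρ, F)` with grading `Γ` is an even Fredholm module over `A`. -/
structure IsEvenFredholmModule {H : Type*} [NormedAddCommGroup H] [InnerProductSpace ℂ H]
    [CompleteSpace H] (ρ : A →⋆ₙₐ[ℂ] (H →L[ℂ] H)) (F Γ : H →L[ℂ] H) : Prop where
  compact_adjoint : IsCompactOperator (star F - F : H →L[ℂ] H)
  compact_square : IsCompactOperator (1 - F * F : H →L[ℂ] H)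
  compact_commutator : ∀ a, IsCompactOperator (F * ρ a - ρ a * F : H →L[ℂ] H)
  grading_selfAdjoint : star Γ = Γ
  grading_square : Γ * Γ = 1
  grading_anticomm : Γ * F = -(F * Γ)
  grading_comm : ∀ a, Γ * ρ a = ρ a * Γ

variable {H₀ H₁ : Type*}
  [NormedAddCommGroup H₀] [InnerProductSpace ℂ H₀]
  [NormedAddCommGroup H₁] [InnerProductSpace ℂ H₁]

/-- The operator `(u, v) ↦ (a u + b v, c u + d v)` on the Hilbert sum `H₀ ⊕ H₁`. -/
def blockOp (a : H₀ →L[ℂ] H₀) (b : H₁ →L[ℂ] H₀) (c : H₀ →L[ℂ] H₁) (d : H₁ →L[ℂ] H₁) :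
    WithLp 2 (H₀ × H₁) →L[ℂ] WithLp 2 (H₀ × H₁) :=
  (WithLp.prodContinuousLinearEquiv 2 ℂ H₀ H₁).symm.toContinuousLinearMap ∘L
    (((a.coprod b).prod (c.coprod d)) ∘L
      (WithLp.prodContinuousLinearEquiv 2 ℂ H₀ H₁).toContinuousLinearMap)

theorem blockOp_apply (a : H₀ →L[ℂ] H₀) (b : H₁ →L[ℂ] H₀) (c : H₀ →L[ℂ] H₁)
    (d : H₁ →L[ℂ] H₁) (x : WithLp 2 (H₀ × H₁)) :
    blockOp a b c d x = WithLp.toLp 2 (a x.fst + b x.snd, c x.fst + d x.snd) := rfl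

variable [CompleteSpace H₀] [CompleteSpace H₁]

/-- The direct sum `ρ₀ ⊕ ρ₁` of two representations. -/
def sumRep (ρ₀ : A →⋆ₙₐ[ℂ] (H₀ →L[ℂ] H₀)) (ρ₁ : A →⋆ₙₐ[ℂ] (H₁ →L[ℂ] H₁)) :
    A →⋆ₙₐ[ℂ] (WithLp 2 (H₀ × H₁) →L[ℂ] WithLp 2 (H₀ × H₁)) where
  toFun a := blockOp (ρ₀ a) 0 0 (ρ₁ a)
  map_smul' c a := by
    ext x : 1
    simp [blockOp_apply, ← WithLp.toLp_smul]
  map_zero' := by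
    ext x : 1
    simp [blockOp_apply]
  map_add' a b := by
    ext x : 1
    simp [blockOp_apply, ← WithLp.toLp_add]
  map_mul' a b := by
    ext x : 1
    simp [blockOp_apply]
  map_star' a := by
    rw [ContinuousLinearMap.star_eq_adjoint, ContinuousLinearMap.eq_adjoint_iff]
    intro x y
    simp [blockOp_apply, WithLp.prod_inner_apply, map_star, ContinuousLinearMap.star_eq_adjoint,
      ContinuousLinearMap.adjoint_inner_left]

/-- The operator `F` with blocks `0, G, G*, 0` on `H₀ ⊕ H₁`, for `G : H₁ → H₀`. -/
def offDiagonal (G : H₁ →L[ℂ] H₀) : WithLp 2 (H₀ × H₁) →L[ℂ] WithLp 2 (H₀ × H₁) :=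
  blockOp 0 G (ContinuousLinearMap.adjoint G) 0

/-- The grading of `H₀ ⊕ H₁`: `1` on `H₀` (even) and `-1` on `H₁` (odd). -/
def grading (H₀ H₁ : Type*)
    [NormedAddCommGroup H₀] [InnerProductSpace ℂ H₀] [CompleteSpace H₀]
    [NormedAddCommGroup H₁] [InnerProductSpace ℂ H₁] [CompleteSpace H₁] :
    WithLp 2 (H₀ × H₁) →L[ℂ] WithLp 2 (H₀ × H₁) :=
  blockOp (ContinuousLinearMap.id ℂ H₀) 0 0 (-ContinuousLinearMap.id ℂ H₁)

end Fredholm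

/-! ### The group `K₀` of a unital C*-algebra -/

section KTheory

/-- A projection in a matrix algebra `M_n(A)`. -/
structure MatProj (A : Type*) [Ring A] [StarRing A] where
  /-- the size of the matrix -/
  n : ℕ
  /-- the matrix -/
  p : Matrix (Fin n) (Fin n) A
  isProj : IsStarProjection p

variable {A : Type*} [Ring A] [StarRing A]

/-- Murray–von Neumann equivalence: `p = v* v` and `q = v v*` for a rectangular matrix `v`. -/
def MatProj.Equivalent (P Q : MatProj A) : Prop :=
  ∃ v : Matrix (Fin Q.n) (Fin P.n) A, vᴴ * v = P.p ∧ v * vᴴ = Q.p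

/-- The orthogonal direct sum `p ⊕ q`. -/
def MatProj.oplus (P Q : MatProj A) : MatProj A where
  n := P.n + Q.n
  p := (Matrix.fromBlocks P.p 0 0 Q.p).submatrix finSumFinEquiv.symm finSumFinEquiv.symm
  isProj := by
    have hP := P.isProj
    have hQ := Q.isProj
    rw [isStarProjection_iff'] at hP hQ ⊢
    refine ⟨?_, ?_⟩
    · rw [Matrix.submatrix_mul_equiv, Matrix.fromBlocks_multiply]
      simp [hP.1, hQ.1]
    · rw [Matrix.star_eq_conjTranspose, Matrix.conjTranspose_submatrix,
        Matrix.fromBlocks_conjTranspose]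
      rw [Matrix.star_eq_conjTranspose] at hP hQ
      simp [hP.2, hQ.2]

variable (A) in
/-- The relations `[p ⊕ q] = [p] + [q]`, and `[p] = [q]` for equivalent `p`, `q`. -/
def K0Relations : AddSubgroup (FreeAbelianGroup (MatProj A)) :=
  AddSubgroup.closure
    ({x | ∃ P Q : MatProj A, x = FreeAbelianGroup.of (P.oplus Q) -
        (FreeAbelianGroup.of P + FreeAbelianGroup.of Q)} ∪
     {x | ∃ P Q : MatProj A, P.Equivalent Q ∧
        x = FreeAbelianGroup.of P - FreeAbelianGroup.of Q})

variable (A) in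
/-- `K₀(A)` for unital `A`: the Grothendieck group of the monoid of equivalence classes of
projections in matrices over `A` under `⊕`, given by generators and relations. -/
abbrev K0 : Type _ := FreeAbelianGroup (MatProj A) ⧸ K0Relations A

/-- The class `[p]₀` in `K₀(A)`. -/
def K0.mk (P : MatProj A) : K0 A := QuotientAddGroup.mk (FreeAbelianGroup.of P)

end KTheory

/-! ### The identification of `K₀(C(X))` with `C(X, ℤ)` by the rank -/

section Rank

variable {X : Type*} [TopologicalSpace X]

/-- The value at `z` of a matrix-valued function. -/
def evalMatrix {m n : ℕ} (M : Matrix (Fin m) (Fin n) C(X, ℂ)) (z : X) :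
    Matrix (Fin m) (Fin n) ℂ := M.map fun f => f z

theorem evalMatrix_mul {l m n : ℕ} (M : Matrix (Fin l) (Fin m) C(X, ℂ))
    (N : Matrix (Fin m) (Fin n) C(X, ℂ)) (z : X) :
    evalMatrix (M * N) z = evalMatrix M z * evalMatrix N z := by
  ext i j
  simp [evalMatrix, Matrix.mul_apply]

theorem rank_eq_trace {n : ℕ} (M : Matrix (Fin n) (Fin n) ℂ) (h : M * M = M) :
    (M.rank : ℂ) = M.trace := by
  have hp : LinearMap.IsProj (LinearMap.range M.mulVecLin) M.mulVecLin := by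
    refine ⟨fun x => ⟨x, rfl⟩, ?_⟩
    rintro _ ⟨x, rfl⟩
    simp [Matrix.mulVec_mulVec, h]
  have := hp.trace
  rw [Matrix.rank, ← this, ← Matrix.toLin'_apply', Matrix.trace_toLin'_eq]

theorem MatProj.rank_eq (P : MatProj C(X, ℂ)) (z : X) :
    ((evalMatrix P.p z).rank : ℂ) = (evalMatrix P.p z).trace :=
  rank_eq_trace _ (by rw [← evalMatrix_mul, P.isProj.isIdempotentElem.eq])

/-- The rank function `z ↦ rank p(z)` of a projection over `C(X)`. -/
def MatProj.rankFn (P : MatProj C(X, ℂ)) : C(X, ℤ) where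
  toFun z := ((evalMatrix P.p z).rank : ℤ)
  continuous_toFun := by
    rw [(Int.isClosedEmbedding_coe_real).isEmbedding.continuous_iff]
    have h : ((fun k : ℤ => (k : ℝ)) ∘ fun z => ((evalMatrix P.p z).rank : ℤ)) =
        fun z => ((evalMatrix P.p z).trace).re := by
      funext z
      rw [← P.rank_eq z]
      simp
    rw [h]
    refine Complex.continuous_re.comp ?_
    simp only [Matrix.trace, Matrix.diag, evalMatrix, Matrix.map_apply]
    exact continuous_finsetSum _ fun i _ => (P.p i i).continuous

theorem MatProj.rankFn_oplus (P Q : MatProj C(X, ℂ)) :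
    (P.oplus Q).rankFn = P.rankFn + Q.rankFn := by
  ext z
  have h : ((evalMatrix (P.oplus Q).p z).rank : ℂ) =
      (evalMatrix P.p z).rank + (evalMatrix Q.p z).rank := by
    rw [MatProj.rank_eq, MatProj.rank_eq, MatProj.rank_eq]
    simp only [Matrix.trace, Matrix.diag, evalMatrix, Matrix.map_apply, MatProj.oplus,
      Matrix.submatrix_apply]
    refine (Equiv.sum_comp (finSumFinEquiv (m := P.n) (n := Q.n)) _).symm.trans ?_
    simp
  have h' : (evalMatrix (P.oplus Q).p z).rank =
      (evalMatrix P.p z).rank + (evalMatrix Q.p z).rank := by exact_mod_cast h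
  change ((evalMatrix (P.oplus Q).p z).rank : ℤ) =
    ((evalMatrix P.p z).rank : ℤ) + ((evalMatrix Q.p z).rank : ℤ)
  exact_mod_cast h'

theorem MatProj.rankFn_equivalent {P Q : MatProj C(X, ℂ)} (h : P.Equivalent Q) :
    P.rankFn = Q.rankFn := by
  ext z
  obtain ⟨v, hv, hw⟩ := h
  have h : ((evalMatrix P.p z).rank : ℂ) = (evalMatrix Q.p z).rank := by
    rw [MatProj.rank_eq, MatProj.rank_eq, ← hv, ← hw, evalMatrix_mul, evalMatrix_mul,
      Matrix.trace_mul_comm]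
  change ((evalMatrix P.p z).rank : ℤ) = ((evalMatrix Q.p z).rank : ℤ)
  exact_mod_cast h

/-- The homomorphism `K₀(C(X)) → C(X, ℤ)`, `[p]₀ ↦ (z ↦ rank p(z))`. For compact totally
disconnected `X` it is the canonical isomorphism. -/
def K0.dim : K0 C(X, ℂ) →+ C(X, ℤ) :=
  QuotientAddGroup.lift (K0Relations C(X, ℂ)) (FreeAbelianGroup.lift MatProj.rankFn) (by
    rw [K0Relations, AddSubgroup.closure_le]
    rintro x (⟨P, Q, rfl⟩ | ⟨P, Q, h, rfl⟩)
    · simp [AddMonoidHom.mem_ker, MatProj.rankFn_oplus]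
    · simp [AddMonoidHom.mem_ker, MatProj.rankFn_equivalent h])

end Rank

/-! ### The index pairing -/

section Pairing

variable {A : Type*} [CStarAlgebra A]
  {H₀ H₁ : Type*}
  [NormedAddCommGroup H₀] [InnerProductSpace ℂ H₀] [CompleteSpace H₀]
  [NormedAddCommGroup H₁] [InnerProductSpace ℂ H₁] [CompleteSpace H₁]

/-- The operator `ρ(p)` on `H ⊗ ℂⁿ = Hⁿ` of a matrix `p` over `A`. The norm on `Hⁿ` here is the
maximum norm, equivalent to the Hilbert norm. -/
def amplify {H : Type*} [NormedAddCommGroup H] [InnerProductSpace ℂ H] [CompleteSpace H]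
    (ρ : A →⋆ₙₐ[ℂ] (H →L[ℂ] H)) {n : ℕ} (p : Matrix (Fin n) (Fin n) A) :
    (Fin n → H) →L[ℂ] (Fin n → H) :=
  ContinuousLinearMap.pi fun i => ∑ j, ρ (p i j) ∘L ContinuousLinearMap.proj j

/-- The operator `ρ₀(p) G ρ₁(p) : Ran ρ₁(p) → Ran ρ₀(p)`, where `G` acts on each of the `n`
components. -/
def compression (ρ₀ : A →⋆ₙₐ[ℂ] (H₀ →L[ℂ] H₀)) (ρ₁ : A →⋆ₙₐ[ℂ] (H₁ →L[ℂ] H₁))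
    (G : H₁ →L[ℂ] H₀) (P : MatProj A) :
    (amplify ρ₁ P.p).range →L[ℂ] (amplify ρ₀ P.p).range :=
  (amplify ρ₀ P.p ∘L (ContinuousLinearMap.pi fun i => G ∘L ContinuousLinearMap.proj i) ∘L
    amplify ρ₁ P.p ∘L (amplify ρ₁ P.p).range.subtypeL).codRestrict _
      fun _ => ⟨_, rfl⟩

/-- The index `dim ker T - dim coker T` of an operator; meant for Fredholm operators. -/
def index {V W : Type*} [NormedAddCommGroup V] [NormedSpace ℂ V] [NormedAddCommGroup W]
    [NormedSpace ℂ W] (T : V →L[ℂ] W) : ℤ :=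
  (Module.finrank ℂ T.ker : ℤ) - (Module.finrank ℂ (W ⧸ T.range) : ℤ)

/-- `ind : K₀(A) → ℤ` is the index pairing with the even Fredholm module
`(H₀ ⊕ H₁, ρ₀ ⊕ ρ₁, F)` where `F` has the off-diagonal entries `G`, `G*`: for each matrix
projection `p` the operator `ρ₀(p) G ρ₁(p)` is Fredholm, of index `ind [p]₀`. -/
def IsIndexPairing (ρ₀ : A →⋆ₙₐ[ℂ] (H₀ →L[ℂ] H₀)) (ρ₁ : A →⋆ₙₐ[ℂ] (H₁ →L[ℂ] H₁))
    (G : H₁ →L[ℂ] H₀) (ind : K0 A →+ ℤ) : Prop :=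
  ∀ P : MatProj A, (compression ρ₀ ρ₁ G P).IsFredholm ∧
    ind (K0.mk P) = index (compression ρ₀ ρ₁ G P)

end Pairing

/-! ### Diagonal representations and the module of `Φ` -/

section Diagonal

variable {ι X : Type*} [TopologicalSpace X] [CompactSpace X]

/-- Evaluation at a point of `X`, and the zero functional for a missing point. -/
def evalOption (f : C(X, ℂ)) (x : Option X) : ℂ := x.elim 0 f

theorem norm_evalOption_le (f : C(X, ℂ)) (x : Option X) : ‖evalOption f x‖ ≤ ‖f‖ := by
  cases x with
  | none => simp [evalOption]
  | some x => exact f.norm_coe_le_norm x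

/-- The diagonal operator with entry `f(pt i)` at the basis vector with label `i`. -/
def diagOp (pt : ι → Option X) (f : C(X, ℂ)) : ℓ²(ι, ℂ) →L[ℂ] ℓ²(ι, ℂ) :=
  lp.mapCLM 2 (fun i => evalOption f (pt i) • ContinuousLinearMap.id ℂ ℂ) (K := ‖f‖)
    (norm_nonneg f) (fun i => by
      simpa [norm_smul] using norm_evalOption_le f (pt i))

theorem diagOp_apply (pt : ι → Option X) (f : C(X, ℂ)) (v : ℓ²(ι, ℂ)) (i : ι) :
    diagOp pt f v i = evalOption f (pt i) * v i := rfl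

/-- The diagonal representation of `C(X)` on `ℓ²(ι)` by evaluations at the points `pt i`. -/
def diagRep (pt : ι → Option X) : C(X, ℂ) →⋆ₙₐ[ℂ] (ℓ²(ι, ℂ) →L[ℂ] ℓ²(ι, ℂ)) where
  toFun := diagOp pt
  map_smul' c f := by
    ext v i
    cases h : pt i <;> simp [diagOp_apply, evalOption, h, mul_assoc]
  map_zero' := by
    ext v i
    cases h : pt i <;> simp [diagOp_apply, evalOption, h]
  map_add' f g := by
    ext v i
    cases h : pt i <;> simp [diagOp_apply, evalOption, h, add_mul]
  map_mul' f g := by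
    ext v i
    cases h : pt i <;> simp [diagOp_apply, evalOption, h, mul_assoc]
  map_star' f := by
    rw [ContinuousLinearMap.star_eq_adjoint, ContinuousLinearMap.eq_adjoint_iff]
    intro v w
    rw [lp.inner_eq_tsum, lp.inner_eq_tsum]
    refine tsum_congr fun i => ?_
    rw [diagOp_apply, diagOp_apply]
    cases h : pt i
    · simp [evalOption]
    · simp only [evalOption, Option.elim_some, ContinuousMap.star_apply, RCLike.inner_apply,
        map_mul, RCLike.star_def, RCLike.conj_conj]
      ring

end Diagonal

section PhiModule

variable {S} (Φ : C(ZS S, ℤ) →+ ℤ)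

/-- The coefficient `φ_{(y)} = Φ(1_{(y)})` of `Φ = ∑ φ_{(y)} e_{(y)}`, the `e_{(y)}` being dual
to the generators `1_{(y)}`. -/
def coeff (y : ℕ) : ℤ := Φ (generator S y)

/-- The labels `(y, j)`, `1 ≤ j ≤ |φ_{(y)}|`, of the basis vectors of `H_ev` and of `H_odd`. The
sign `±` of the basis vector is the sign of `φ_{(y)}`; there is no label when `φ_{(y)} = 0`. -/
abbrev Label : Type := Σ y : ℕ, Fin (coeff Φ y).natAbs

/-- The Hilbert space `H_ev`, with its basis `E^{ev,±}_{(y,j)}`. -/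
abbrev Hev : Type := ℓ²(Label Φ, ℂ)

/-- The Hilbert space `H_odd`, with its basis `E^{odd,±}_{(y,j)}`. -/
abbrev Hodd : Type := ℓ²(Label Φ, ℂ)

/-- `γ(y)` as a point of `ℤ_S`. -/
def gamPoint (y : ℕ) : Option (ZS S) := (S.gam y).map fun x => (x : ZS S)

/-- The point of evaluation on `E^{ev,±}_{(y,j)}`: `γ(y)` for `+` and `y` for `-`. -/
def evPoint (i : Label Φ) : Option (ZS S) :=
  if 0 < coeff Φ i.1 then gamPoint i.1 else some ((i.1 : ℕ) : ZS S)

/-- The point of evaluation on `E^{odd,±}_{(y,j)}`: `y` for `+` and `γ(y)` for `-`. -/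
def oddPoint (i : Label Φ) : Option (ZS S) :=
  if 0 < coeff Φ i.1 then some ((i.1 : ℕ) : ZS S) else gamPoint i.1

/-- The representation `ρ_ev` on `H_ev`. -/
def rhoEv : C(ZS S, ℂ) →⋆ₙₐ[ℂ] (Hev Φ →L[ℂ] Hev Φ) := diagRep (evPoint Φ)

/-- The representation `ρ_odd` on `H_odd`. -/
def rhoOdd : C(ZS S, ℂ) →⋆ₙₐ[ℂ] (Hodd Φ →L[ℂ] Hodd Φ) := diagRep (oddPoint Φ)

/-- The unitary `G : H_odd → H_ev` with `G E^{odd,±}_{(y,j)} = E^{ev,±}_{(y,j)}`. -/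
def swap : Hodd Φ ≃ₗᵢ[ℂ] Hev Φ := LinearIsometryEquiv.refl ℂ _

/-- `G` as a bounded operator. -/
def swapL : Hodd Φ →L[ℂ] Hev Φ := (swap Φ).toContinuousLinearEquiv.toContinuousLinearMap

end PhiModule

end Odometer

end

/-! Both Hilbert spaces are `ℓ²` over the same labels and `G` is the identity, so everything reduces
to comparing two diagonal representations. The entries of their difference are `±(f(y) - f(γ(y)))`.
Since `y` and `γ(y)` agree modulo `s_{n(y)-1}`, uniform continuity of `f` makes these entries tend
to zero, only finitely many labels lying below any bound on `y`. The difference is therefore a norm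
limit of finite-rank operators, which gives the compact commutators
(`isEvenFredholmModule_of_unitary`).

For the index, let `e` and `o` be the values of a projection `p` at the even and the odd point of a
label. Outside a finite set `F` of labels they are uniformly close, and `1 + (2e - 1)(o - e)` is an
invertible intertwiner of `o` and `e`. Hence the compression is an isomorphism between the parts of
the two ranges that vanish on `F`, and its index is the difference of their codimensions, the sum
over `F` of `rank o - rank e` (`isFredholm_and_index_compression`).

Taking for `F` the labels with `y < s_M`, the multiplicities and signs turn this sum into `∑ φ_(y)
(r(y) - r(γ(y)))`, where `r` is the rank function. A telescoping argument gives `r = ∑ (r(y) -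
r(γ(y))) 1_(y)` over `y < s_M` for large `M` (`exists_eq_sum_generator`), so the sum is `Φ(r)`. -/

namespace Odometer

/-! ### Residues, predecessors and the telescoping expansion -/

section Arithmetic

variable (S : Scale)

theorem Scale.s_mono : Monotone S.s :=
  monotone_nat_of_le_succ fun m => Nat.le_of_dvd (S.pos _) (S.dvd m)

theorem Scale.s_dvd {m n : ℕ} (h : m ≤ n) : S.s m ∣ S.s n := by
  induction n, h using Nat.le_induction with
  | base => exact dvd_rfl
  | succ k _ ih => exact ih.trans (S.dvd k)

theorem Scale.level_eq_succ {x m : ℕ} (h₁ : S.s m ≤ x) (h₂ : x < S.s (m + 1)) :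
    S.level x = m + 1 := by
  rw [Scale.level, Nat.find_eq_iff]
  exact ⟨h₂, fun k hk => not_lt.mpr ((S.s_mono (Nat.lt_succ_iff.mp hk)).trans h₁)⟩

theorem Scale.level_zero : S.level 0 = 0 := by
  rw [Scale.level, Nat.find_eq_zero, S.s_zero]
  exact Nat.one_pos

theorem Scale.lt_level {x N : ℕ} (h : S.s N ≤ x) : N < S.level x := by
  rw [Scale.level, Nat.lt_find_iff]
  exact fun k hk => not_lt.mpr ((S.s_mono hk).trans h)

theorem Scale.gam_zero : S.gam 0 = none := if_pos rfl

theorem Scale.gam_of_pos {x : ℕ} (hx : 0 < x) :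
    S.gam x = some (x % S.s (S.level x - 1)) := if_neg hx.ne'

theorem natCast_apply (x m : ℕ) : ((x : ZS S) : ∀ m, ZMod (S.s m)) m = x := by
  simp

theorem castHom_apply (z : ZS S) (m : ℕ) :
    ZMod.castHom (S.dvd m) (ZMod (S.s m)) (z.1 (m + 1)) = z.1 m := z.2 m

/-- Points that agree at some level agree at all lower levels. -/
theorem apply_eq_of_le {z w : ZS S} {m n : ℕ} (hmn : m ≤ n) (h : z.1 n = w.1 n) :
    z.1 m = w.1 m := by
  induction n, hmn using Nat.le_induction with
  | base => exact h
  | succ k _ ih => exact ih (by rw [← castHom_apply S z k, ← castHom_apply S w k, h])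

/-- The representative of `z` modulo `s_m` in `{0, …, s_m - 1}`. -/
def residue (z : ZS S) (m : ℕ) : ℕ := (z.1 m).val

theorem residue_lt (z : ZS S) (m : ℕ) : residue S z m < S.s m :=
  haveI : NeZero (S.s m) := ⟨(S.pos m).ne'⟩
  ZMod.val_lt _

theorem natCast_residue (z : ZS S) (m : ℕ) : (residue S z m : ZMod (S.s m)) = z.1 m :=
  haveI : NeZero (S.s m) := ⟨(S.pos m).ne'⟩
  ZMod.natCast_zmod_val _

theorem residue_succ_mod (z : ZS S) (m : ℕ) :
    residue S z (m + 1) % S.s m = residue S z m := by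
  have : NeZero (S.s m) := ⟨(S.pos m).ne'⟩
  have h := castHom_apply S z m
  rw [← natCast_residue, ← natCast_residue, map_natCast] at h
  rw [ZMod.natCast_eq_natCast_iff] at h
  exact Nat.mod_eq_of_modEq h (residue_lt S z m)

theorem apply_eq_natCast_iff (z : ZS S) {m y : ℕ} (hy : y < S.s m) :
    z.1 m = (y : ZMod (S.s m)) ↔ residue S z m = y := by
  have : NeZero (S.s m) := ⟨(S.pos m).ne'⟩
  rw [← natCast_residue, ZMod.natCast_eq_natCast_iff, Nat.ModEq,
    Nat.mod_eq_of_lt (residue_lt S z m), Nat.mod_eq_of_lt hy]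

theorem generator_apply (y : ℕ) (z : ZS S) :
    generator S y z = if z.1 (S.level y) = (y : ZMod (S.s (S.level y))) then 1 else 0 := rfl

/-- The increment `f(y) - f(γ(y))`, with `f(γ(0)) = 0`. -/
def increment {S : Scale} (f : C(ZS S, ℤ)) (y : ℕ) : ℤ :=
  f (y : ZS S) - (gamPoint (S := S) y).elim 0 f

/-- The sum telescopes along the residues of `z`: among the `y` in `[s_m, s_{m+1})`, only the
residue of `z` modulo `s_{m+1}` can contribute, and its predecessor is the residue modulo `s_m`. -/
theorem sum_increment_generator_apply (f : C(ZS S, ℤ)) (z : ZS S) (m : ℕ) :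
    ∑ y ∈ Finset.range (S.s m), increment f y * generator S y z =
      f ((residue S z m : ℕ) : ZS S) := by
  induction m with
  | zero =>
    have h := residue_lt S z 0
    rw [S.s_zero] at h ⊢
    -- As `s_0 = 1`, the generator at `0` is constantly `1`; the missing predecessor makes its
    -- coefficient `f(0)`, which starts the telescope.
    have hz : z.1 (S.level 0) = ((0 : ℕ) : ZMod (S.s (S.level 0))) := by
      rw [S.level_zero, apply_eq_natCast_iff S z (S.pos 0)]
      omega
    rw [Finset.sum_range_one, generator_apply, if_pos hz, Nat.lt_one_iff.mp h]
    simp [increment, gamPoint, S.gam_zero]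
  | succ m ih =>
    rw [← Finset.sum_range_add_sum_Ico _ (S.s_mono m.le_succ), ih]
    have hgen : ∀ y ∈ Finset.Ico (S.s m) (S.s (m + 1)), increment f y * generator S y z =
        if residue S z (m + 1) = y then increment f y else 0 := by
      intro y hy
      rw [Finset.mem_Ico] at hy
      have hl := S.level_eq_succ hy.1 hy.2
      rw [generator_apply, hl]
      simp only [apply_eq_natCast_iff S z hy.2, mul_ite, mul_one, mul_zero]
    rw [Finset.sum_congr rfl hgen, Finset.sum_ite_eq]
    have hmod := residue_succ_mod S z m
    -- Either the new residue is at least `s_m` and its increment moves the value from the old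
    -- residue to the new one, or it is below `s_m` and equals the old residue.
    split_ifs with hmem
    · rw [Finset.mem_Ico] at hmem
      have hl := S.level_eq_succ hmem.1 hmem.2
      have hpos := (S.pos m).trans_le hmem.1
      rw [increment, gamPoint, S.gam_of_pos hpos, hl, Nat.add_sub_cancel, hmod]
      simp
    · have hlt : residue S z (m + 1) < S.s m := by
        by_contra hge
        exact hmem (Finset.mem_Ico.mpr ⟨not_lt.mp hge, residue_lt S z (m + 1)⟩)
      rw [Nat.mod_eq_of_lt hlt] at hmod
      rw [hmod, add_zero]

end Arithmetic

/-! ### Uniform continuity on the odometer -/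

section Continuity

variable (S : Scale)

/-- A neighbourhood of `z` contains all points that agree with `z` at some level. -/
theorem exists_cylinder_subset {z : ZS S} {U : Set (ZS S)} (hU : U ∈ nhds z) :
    ∃ n, ∀ w : ZS S, w.1 n = z.1 n → w ∈ U := by
  rw [nhds_subtype_eq_comap, Filter.mem_comap] at hU
  obtain ⟨V, hV, hVU⟩ := hU
  rw [nhds_pi, Filter.mem_pi] at hV
  obtain ⟨I, hI, t, ht, htV⟩ := hV
  -- A basic neighbourhood restricts finitely many components, and the component at an upper bound
  -- of their indices determines them all.
  obtain ⟨n, hn⟩ := hI.bddAbove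
  refine ⟨n, fun w hw => hVU (htV fun i hi => ?_)⟩
  rw [apply_eq_of_le S (hn hi) hw]
  exact mem_of_mem_nhds (ht i)

/-- Continuous functions on `ℤ_S` are uniformly continuous for the levels. -/
theorem exists_level_dist_lt {E : Type*} [PseudoMetricSpace E] (f : C(ZS S, E)) {ε : ℝ}
    (hε : 0 < ε) : ∃ N, ∀ z w : ZS S, z.1 N = w.1 N → dist (f z) (f w) < ε := by
  have hloc : ∀ z : ZS S, ∃ n, ∀ w : ZS S, w.1 n = z.1 n → dist (f w) (f z) < ε / 2 :=
    fun z => exists_cylinder_subset S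
      (f.continuous.continuousAt (Metric.ball_mem_nhds (f z) (half_pos hε)))
  choose n hn using hloc
  have hopen : ∀ z : ZS S, {w : ZS S | w.1 (n z) = z.1 (n z)} ∈ nhds z := fun z => by
    have hcont : Continuous fun w : ZS S => w.1 (n z) :=
      (continuous_apply (n z)).comp continuous_subtype_val
    exact (hcont.isOpen_preimage {z.1 (n z)} (isOpen_discrete _)).mem_nhds rfl
  obtain ⟨t, ht⟩ := CompactSpace.elim_nhds_subcover _ hopen
  -- Agreement at the highest level of the finite subcover puts `z` and `w` in a common cylinder.
  refine ⟨t.sup n, fun z w hzw => ?_⟩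
  have hz : z ∈ ⋃ x ∈ t, {w : ZS S | w.1 (n x) = x.1 (n x)} := ht ▸ Set.mem_univ z
  simp only [Set.mem_iUnion] at hz
  obtain ⟨x, hx, hzx⟩ := hz
  have hzx : z.1 (n x) = x.1 (n x) := hzx
  have hw : w.1 (n x) = x.1 (n x) :=
    (apply_eq_of_le S (Finset.le_sup hx) hzw.symm).trans hzx
  calc dist (f z) (f w) ≤ dist (f z) (f x) + dist (f w) (f x) := dist_triangle_right _ _ _
    _ < ε / 2 + ε / 2 := add_lt_add (hn x z hzx) (hn x w hw)
    _ = ε := add_halves ε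

/-- An integer-valued continuous function is a finite combination of generators. -/
theorem exists_eq_sum_generator (f : C(ZS S, ℤ)) :
    ∃ N, ∀ M, N ≤ M → f = ∑ y ∈ Finset.range (S.s M), increment f y • generator S y := by
  -- Integers at distance less than `1` coincide, so `f` depends only on the residue at level `N`,
  -- where the telescoping sum is exact.
  obtain ⟨N, hN⟩ := exists_level_dist_lt S f one_pos
  refine ⟨N, fun M hM => ?_⟩
  ext z
  rw [ContinuousMap.sum_apply]
  simp only [ContinuousMap.smul_apply, smul_eq_mul]
  rw [sum_increment_generator_apply]
  have h := hN z ((residue S z M : ℕ) : ZS S)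
    (apply_eq_of_le S hM (by rw [natCast_apply, natCast_residue]))
  rw [Int.dist_eq] at h
  have h' : |f z - f ((residue S z M : ℕ) : ZS S)| < 1 := by exact_mod_cast h
  exact sub_eq_zero.mp (Int.abs_lt_one_iff.mp h')

theorem exists_gamPoint_dist_lt (f : C(ZS S, ℂ)) {ε : ℝ} (hε : 0 < ε) :
    ∃ N, ∀ y, S.s N ≤ y →
      ‖evalOption f (some (y : ZS S)) - evalOption f (gamPoint y)‖ < ε := by
  obtain ⟨N, hN⟩ := exists_level_dist_lt S f hε
  refine ⟨N, fun y hy => ?_⟩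
  have hy0 : 0 < y := (S.pos N).trans_le hy
  -- The point `γ(y)` is congruent to `y` modulo `s_{n(y)-1}`, and `s_N ≤ y` gives `N ≤ n(y) - 1`.
  have h := hN y ((y % S.s (S.level y - 1) : ℕ) : ZS S) (by
    rw [natCast_apply, natCast_apply, ZMod.natCast_eq_natCast_iff]
    exact (Nat.mod_modEq y _).symm.of_dvd
      (S.s_dvd (Nat.le_sub_one_of_lt (S.lt_level hy))))
  rw [dist_eq_norm] at h
  simpa [gamPoint, S.gam_of_pos hy0, evalOption] using h

end Continuity

/-! ### Index of an operator from subspaces of finite codimension -/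

section FredholmIndex

/-- A linear map that is bijective from `V₁` to `W₁`, subspaces of finite codimension, has the
difference of the codimensions as its index. -/
theorem finrank_ker_sub_finrank_coker {K V W : Type*} [Field K] [AddCommGroup V] [Module K V]
    [AddCommGroup W] [Module K W] (T : V →ₗ[K] W) {V₁ : Submodule K V} {W₁ : Submodule K W}
    [Module.Finite K (V ⧸ V₁)] [Module.Finite K (W ⧸ W₁)] (hT : V₁ ≤ W₁.comap T)
    (hinj : ∀ v ∈ V₁, T v = 0 → v = 0) (hsurj : ∀ w ∈ W₁, ∃ v ∈ V₁, T v = w) :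
    (Module.finrank K T.ker : ℤ) - (Module.finrank K (W ⧸ T.range) : ℤ) =
      (Module.finrank K (V ⧸ V₁) : ℤ) - (Module.finrank K (W ⧸ W₁) : ℤ) := by
  have hle : W₁ ≤ T.range := fun w hw =>
    let ⟨v, _, hv⟩ := hsurj w hw
    ⟨v, hv⟩
  have hrange : (V₁.mapQ W₁ T hT).range = T.range.map W₁.mkQ := by
    rw [← LinearMap.range_comp_of_range_eq_top (f := V₁.mkQ) _ V₁.range_mkQ, V₁.mapQ_mkQ,
      LinearMap.range_comp]
  -- The kernel of `T` maps isomorphically to that of the induced map `V/V₁ → W/W₁`: injectivity on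
  -- `V₁` gives injectivity, and correcting a lift by a preimage in `V₁` gives surjectivity.
  have hker : Module.finrank K T.ker = Module.finrank K (V₁.mapQ W₁ T hT).ker := by
    have hmem : ∀ v : T.ker, (V₁.mkQ ∘ₗ T.ker.subtype) v ∈ (V₁.mapQ W₁ T hT).ker := by
      rintro ⟨v, hv⟩
      rw [LinearMap.mem_ker] at hv
      simp [hv]
    refine (LinearEquiv.ofBijective
      ((V₁.mkQ ∘ₗ T.ker.subtype).codRestrict (V₁.mapQ W₁ T hT).ker hmem) ⟨?_, ?_⟩).finrank_eq
    · rw [← LinearMap.ker_eq_bot, LinearMap.ker_codRestrict, LinearMap.ker_eq_bot']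
      rintro ⟨v, hv⟩ h
      exact Subtype.ext (hinj v (by simpa using h) hv)
    · rintro ⟨q, hq⟩
      obtain ⟨v, rfl⟩ := V₁.mkQ_surjective q
      have hv : T v ∈ W₁ := by simpa using hq
      obtain ⟨v', hv', hTv⟩ := hsurj _ hv
      refine ⟨⟨v - v', by rw [LinearMap.mem_ker, map_sub, hTv, sub_self]⟩, ?_⟩
      ext
      simpa using hv'
  have hcoker : Module.finrank K (W ⧸ T.range) =
      Module.finrank K ((W ⧸ W₁) ⧸ (V₁.mapQ W₁ T hT).range) := by
    rw [hrange]
    exact (Submodule.quotientQuotientEquivQuotient W₁ T.range hle).finrank_eq.symm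
  -- The induced map acts between finite-dimensional spaces, so rank-nullity gives its index.
  have h₁ := (V₁.mapQ W₁ T hT).finrank_range_add_finrank_ker
  have h₂ := (V₁.mapQ W₁ T hT).range.finrank_quotient_add_finrank
  rw [hker, hcoker]
  omega

/-- An operator that maps `V₁` isomorphically onto `W₁`, for closed subspaces `V₁`, `W₁` of finite
codimension, is Fredholm, and its index is the difference of the codimensions. -/
theorem isFredholm_and_index_of_restrict {V W : Type*} [NormedAddCommGroup V] [NormedSpace ℂ V]
    [NormedAddCommGroup W] [NormedSpace ℂ W] (T : V →L[ℂ] W) (R : W →L[ℂ] V)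
    {V₁ : Submodule ℂ V} {W₁ : Submodule ℂ W} (hV₁ : IsClosed (V₁ : Set V))
    (hW₁ : IsClosed (W₁ : Set W)) [V₁.CoFG] [W₁.CoFG]
    (hT : Set.MapsTo T V₁ W₁) (hR : Set.MapsTo R W₁ V₁)
    (hRT : ∀ v ∈ V₁, R (T v) = v) (hTR : ∀ w ∈ W₁, T (R w) = w) :
    T.IsFredholm ∧ index T =
      (Module.finrank ℂ (V ⧸ V₁) : ℤ) - (Module.finrank ℂ (W ⧸ W₁) : ℤ) := by
  refine ⟨.of_isInvertible_restrict hV₁ hW₁ hT (.of_inverse (g := R.restrict hR) ?_ ?_), ?_⟩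
  · ext w
    exact hTR w w.2
  · ext v
    exact hRT v v.2
  · refine finrank_ker_sub_finrank_coker T.toLinearMap hT (fun v hv h => ?_)
      fun w hw => ⟨R w, hR hw, hTR w hw⟩
    have h : T v = 0 := h
    rw [← hRT v hv, h, map_zero]

end FredholmIndex

/-! ### Compact multiplication operators on `ℓ²` -/

section MulOp

variable {ι : Type*}

theorem norm_le_of_apply_eq_mul {D : ℓ²(ι, ℂ) →L[ℂ] ℓ²(ι, ℂ)} {c : ι → ℂ} {ε : ℝ} (hε : 0 ≤ ε)
    (hD : ∀ v i, D v i = c i * v i) (hc : ∀ i, ‖c i‖ ≤ ε) : ‖D‖ ≤ ε := by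
  have h : D = lp.mapCLM 2 (fun i => c i • ContinuousLinearMap.id ℂ ℂ) hε
      (fun i => by simpa [norm_smul] using hc i) := by
    ext v i
    rw [hD]
    rfl
  rw [h]
  exact lp.norm_mapCLM_le ..

/-- The evaluation of an `ℓ²`-family at an index. -/
noncomputable def coordinate (i : ι) : ℓ²(ι, ℂ) →L[ℂ] ℂ :=
  LinearMap.mkContinuous
    { toFun := fun v => v i
      map_add' := fun _ _ => rfl
      map_smul' := fun _ _ => rfl } 1
    (fun v => by
      rw [one_mul]
      exact lp.norm_apply_le_norm two_ne_zero v i)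

theorem coordinate_apply (i : ι) (v : ℓ²(ι, ℂ)) : coordinate i v = v i := rfl

open Classical in
/-- The operator that sets the coordinates in a finite set to zero. -/
noncomputable def cutoff (F : Finset ι) : ℓ²(ι, ℂ) →L[ℂ] ℓ²(ι, ℂ) :=
  lp.mapCLM 2 (fun i => (if i ∈ F then (0 : ℂ) else 1) • ContinuousLinearMap.id ℂ ℂ) zero_le_one
    (fun i => by
      rw [norm_smul]
      split_ifs <;> simp)

open Classical in
theorem cutoff_apply (F : Finset ι) (v : ℓ²(ι, ℂ)) (i : ι) :
    cutoff F v i = if i ∈ F then 0 else v i := by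
  change (if i ∈ F then (0 : ℂ) else 1) * v i = _
  split_ifs <;> simp

open Classical in
/-- The family with the given values on a finite set, and zero elsewhere. -/
noncomputable def ofFinset (F : Finset ι) : (F → ℂ) →ₗ[ℂ] ℓ²(ι, ℂ) :=
  { toFun := fun g => ⟨fun i => if h : i ∈ F then g ⟨i, h⟩ else 0,
      (memℓp_zero (F.finite_toSet.subset fun i hi => by
        by_contra h
        exact hi (dif_neg h))).of_exponent_ge zero_le⟩
    map_add' := fun g g' => by
      ext i
      change (if h : i ∈ F then (g + g') ⟨i, h⟩ else 0) =
        (if h : i ∈ F then g ⟨i, h⟩ else 0) + (if h : i ∈ F then g' ⟨i, h⟩ else 0)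
      split_ifs <;> simp
    map_smul' := fun c g => by
      ext i
      by_cases h : i ∈ F <;> simp [h] }

theorem ofFinset_apply_of_mem (F : Finset ι) (g : F → ℂ) {i : ι} (h : i ∈ F) :
    ofFinset F g i = g ⟨i, h⟩ := dif_pos h

theorem ofFinset_apply_of_notMem (F : Finset ι) (g : F → ℂ) {i : ι} (h : i ∉ F) :
    ofFinset F g i = 0 := dif_neg h

theorem isCompactOperator_one_sub_cutoff (F : Finset ι) :
    IsCompactOperator (1 - cutoff F : ℓ²(ι, ℂ) →L[ℂ] ℓ²(ι, ℂ)) := by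
  have h : (1 - cutoff F : ℓ²(ι, ℂ) →L[ℂ] ℓ²(ι, ℂ)) =
      (LinearMap.toContinuousLinearMap (ofFinset F)) ∘L
        ContinuousLinearMap.pi fun i : F => coordinate i.1 := by
    ext v i
    simp only [sub_apply, one_apply_eq_self, lp.coeFn_sub,
      Pi.sub_apply, cutoff_apply, ContinuousLinearMap.comp_apply,
      LinearMap.coe_toContinuousLinearMap']
    by_cases h : i ∈ F
    · simp [h, ofFinset_apply_of_mem, coordinate_apply]
    · simp [h, ofFinset_apply_of_notMem]
  rw [h]
  exact (isCompactOperator_of_locallyCompactSpace_rng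
    (LinearMap.toContinuousLinearMap (ofFinset F))).comp_clm _

/-- A multiplication operator by a family that tends to zero is compact. -/
theorem isCompactOperator_of_apply_eq_mul {D : ℓ²(ι, ℂ) →L[ℂ] ℓ²(ι, ℂ)} {c : ι → ℂ}
    (hD : ∀ v i, D v i = c i * v i)
    (hc : ∀ ε > 0, ∃ F : Finset ι, ∀ i ∉ F, ‖c i‖ ≤ ε) : IsCompactOperator D := by
  have hcl := isClosed_setOfPred_isCompactOperator (σ₁₂ := RingHom.id ℂ) (M₁ := ℓ²(ι, ℂ))
    (M₂ := ℓ²(ι, ℂ))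
  refine hcl.closure_subset (Metric.mem_closure_iff.mpr fun ε hε => ?_)
  obtain ⟨F, hF⟩ := hc (ε / 2) (half_pos hε)
  -- Keeping only the coordinates in `F` gives a compact operator; the error `D * cutoff F` has
  -- entries bounded by `ε / 2`.
  refine ⟨D * (1 - cutoff F), (isCompactOperator_one_sub_cutoff F).clm_comp D, ?_⟩
  rw [dist_eq_norm, mul_sub, mul_one, sub_sub_cancel]
  classical
  refine (norm_le_of_apply_eq_mul (c := fun i => if i ∈ F then 0 else c i) (half_pos hε).le
    (fun v i => ?_) fun i => ?_).trans_lt (half_lt_self hε)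
  · rw [mul_apply_eq_comp, hD, cutoff_apply]
    split_ifs <;> simp
  · split_ifs with h
    · simpa using (half_pos hε).le
    · exact hF i h

end MulOp

/-! ### Compressions between the ranges of two diagonal representations -/

section Compression

variable {ι X : Type*} [TopologicalSpace X] {n : ℕ}

/-- The value of a matrix-valued function at a point, and zero for a missing point. -/
noncomputable def evalOptionMatrix (M : Matrix (Fin n) (Fin n) C(X, ℂ)) (x : Option X) :
    Matrix (Fin n) (Fin n) ℂ := M.map fun f => evalOption f x

theorem evalOptionMatrix_isIdempotent {M : Matrix (Fin n) (Fin n) C(X, ℂ)} (hM : M * M = M)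
    (x : Option X) : evalOptionMatrix M x * evalOptionMatrix M x = evalOptionMatrix M x := by
  cases x with
  | none =>
    ext i j
    simp [evalOptionMatrix, evalOption, Matrix.mul_apply]
  | some x =>
    have h := evalMatrix_mul M M x
    rw [hM] at h
    exact h.symm

/-- For idempotents `e`, `o`, the element `1 + (2e - 1)(o - e)` intertwines `o` and `e`. -/
theorem intertwiner_mul {R : Type*} [Ring R] {e o : R} (he : e * e = e) (ho : o * o = o) :
    (1 + (2 * e - 1) * (o - e)) * o = e * o := by
  -- For idempotent `e` the element is `e * o + (1 - e) * (1 - o)`; the form in the statement shows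
  -- that it is near `1` when `o` is near `e`.
  have h : (1 + (2 * e - 1) * (o - e)) * o =
      o + 2 * (e * (o * o)) - 2 * (e * e * o) - o * o + e * o := by noncomm_ring
  rw [h, he, ho]
  abel

theorem mul_intertwiner {R : Type*} [Ring R] {e o : R} (he : e * e = e) :
    e * (1 + (2 * e - 1) * (o - e)) = e * o := by
  have h : e * (1 + (2 * e - 1) * (o - e)) =
      e + 2 * (e * e * o) - 2 * (e * e * e) - e * o + e * e := by noncomm_ring
  rw [h, he, he]
  noncomm_ring

/-- The vector of the `i`-th coordinates of `n` families. -/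
noncomputable def column (i : ι) : (Fin n → ℓ²(ι, ℂ)) →L[ℂ] (Fin n → ℂ) :=
  ContinuousLinearMap.pi fun k => coordinate i ∘L ContinuousLinearMap.proj k

theorem column_apply (i : ι) (v : Fin n → ℓ²(ι, ℂ)) (k : Fin n) : column i v k = v k i := rfl

theorem ext_column {v w : Fin n → ℓ²(ι, ℂ)} (h : ∀ i, column i v = column i w) : v = w := by
  ext k i
  exact congrFun (h i) k

variable [CompactSpace X]

theorem column_amplify (pt : ι → Option X) (M : Matrix (Fin n) (Fin n) C(X, ℂ))
    (v : Fin n → ℓ²(ι, ℂ)) (i : ι) :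
    column i (amplify (diagRep pt) M v) = evalOptionMatrix M (pt i) *ᵥ column i v := by
  ext k
  have h : column i (amplify (diagRep pt) M v) k =
      coordinate i (∑ l, diagOp pt (M k l) (v l)) := by
    simp only [column_apply, coordinate_apply, amplify, ContinuousLinearMap.pi_apply,
      sum_apply]
    rfl
  rw [h, map_sum]
  rfl

/-- The range of an idempotent is its fixed space, and a diagonal representation lets fixedness be
tested label by label. -/
theorem mem_range_amplify_iff (pt : ι → Option X) {M : Matrix (Fin n) (Fin n) C(X, ℂ)}
    (hM : M * M = M) (v : Fin n → ℓ²(ι, ℂ)) :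
    v ∈ (amplify (diagRep pt) M).range ↔
      ∀ i, evalOptionMatrix M (pt i) *ᵥ column i v = column i v := by
  constructor
  · rintro ⟨w, rfl⟩ i
    change _ *ᵥ column i (amplify (diagRep pt) M w) = column i (amplify (diagRep pt) M w)
    rw [column_amplify, Matrix.mulVec_mulVec, evalOptionMatrix_isIdempotent hM]
  · intro h
    refine ⟨v, ext_column fun i => ?_⟩
    exact (column_amplify pt M v i).trans (h i)

/-- The elements of the range of `ρ(p)` whose coordinates in a finite set vanish. -/
noncomputable def rangeOff (pt : ι → Option X) (M : Matrix (Fin n) (Fin n) C(X, ℂ)) (F : Finset ι) :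
    Submodule ℂ (amplify (diagRep pt) M).range :=
  ((ContinuousLinearMap.pi fun i : F => column (n := n) i.1) ∘L
    (amplify (diagRep pt) M).range.subtypeL).ker

theorem mem_rangeOff {pt : ι → Option X} {M : Matrix (Fin n) (Fin n) C(X, ℂ)} {F : Finset ι}
    {v : (amplify (diagRep pt) M).range} :
    v ∈ rangeOff pt M F ↔ ∀ i ∈ F, column i v.1 = 0 := by
  rw [rangeOff, LinearMap.mem_ker]
  refine ⟨fun h i hi => congrFun h ⟨i, hi⟩, fun h => ?_⟩
  funext i
  exact h i.1 i.2

theorem isClosed_rangeOff (pt : ι → Option X) (M : Matrix (Fin n) (Fin n) C(X, ℂ))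
    (F : Finset ι) : IsClosed (rangeOff pt M F : Set (amplify (diagRep pt) M).range) :=
  ContinuousLinearMap.isClosed_ker _

/-- Reading off the coordinates in `F` has kernel `rangeOff`. It is onto because vectors chosen in
the fibre ranges over `F` and extended by zero are again fixed by `ρ(p)`. -/
theorem nonempty_quotient_rangeOff_equiv (pt : ι → Option X)
    {M : Matrix (Fin n) (Fin n) C(X, ℂ)} (hM : M * M = M) (F : Finset ι) :
    Nonempty (((amplify (diagRep pt) M).range ⧸ rangeOff pt M F) ≃ₗ[ℂ]
      ∀ i : F, (evalOptionMatrix M (pt i)).mulVecLin.range) := by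
  let q : (amplify (diagRep pt) M).range →ₗ[ℂ]
      ∀ i : F, (evalOptionMatrix M (pt i)).mulVecLin.range :=
    LinearMap.pi fun i => LinearMap.codRestrict _
      ((column i.1).toLinearMap ∘ₗ (amplify (diagRep pt) M).range.subtype)
      fun v => ⟨column i.1 v.1, (mem_range_amplify_iff pt hM v.1).mp v.2 i.1⟩
  have hq : ∀ v i, (q v i : Fin n → ℂ) = column i.1 v.1 := fun _ _ => rfl
  have hker : q.ker = rangeOff pt M F := by
    ext v
    rw [mem_rangeOff, LinearMap.mem_ker]
    refine ⟨fun h i hi => ?_, fun h => ?_⟩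
    · rw [← hq v ⟨i, hi⟩, h]
      rfl
    · funext i
      exact Subtype.ext (h i.1 i.2)
  have hsurj : Function.Surjective q := by
    intro g
    let v : Fin n → ℓ²(ι, ℂ) := fun k => ofFinset F fun i => (g i : Fin n → ℂ) k
    have hv : ∀ i (hi : i ∈ F), column i v = g ⟨i, hi⟩ := fun i hi => by
      ext k
      exact ofFinset_apply_of_mem F (fun i => (g i : Fin n → ℂ) k) hi
    have hv0 : ∀ i ∉ F, column i v = 0 := fun i hi => by
      ext k
      exact ofFinset_apply_of_notMem F (fun i => (g i : Fin n → ℂ) k) hi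
    refine ⟨⟨v, (mem_range_amplify_iff pt hM v).mpr fun i => ?_⟩, ?_⟩
    · by_cases hi : i ∈ F
      · obtain ⟨x, hx⟩ := (g ⟨i, hi⟩).2
        rw [hv i hi, ← hx, Matrix.mulVecLin_apply, Matrix.mulVec_mulVec,
          evalOptionMatrix_isIdempotent hM]
      · rw [hv0 i hi, Matrix.mulVec_zero]
    · funext i
      exact Subtype.ext (hv i.1 i.2)
  rw [← hker]
  exact ⟨q.quotKerEquivOfSurjective hsurj⟩

theorem finite_quotient_rangeOff (pt : ι → Option X)
    {M : Matrix (Fin n) (Fin n) C(X, ℂ)} (hM : M * M = M) (F : Finset ι) :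
    (rangeOff pt M F).CoFG := by
  obtain ⟨e⟩ := nonempty_quotient_rangeOff_equiv pt hM F
  exact Module.Finite.equiv e.symm

theorem finrank_quotient_rangeOff (pt : ι → Option X)
    {M : Matrix (Fin n) (Fin n) C(X, ℂ)} (hM : M * M = M) (F : Finset ι) :
    Module.finrank ℂ ((amplify (diagRep pt) M).range ⧸ rangeOff pt M F) =
      ∑ i ∈ F, (evalOptionMatrix M (pt i)).rank := by
  obtain ⟨e⟩ := nonempty_quotient_rangeOff_equiv pt hM F
  rw [e.finrank_eq, Module.finrank_pi_fintype,
    ← Finset.sum_coe_sort F fun i => (evalOptionMatrix M (pt i)).rank]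
  rfl

/-- The difference `ρ₁(p) - ρ₀(p)` with the coordinates in a finite set removed. -/
noncomputable def truncatedDifference (pt₀ pt₁ : ι → Option X)
    (M : Matrix (Fin n) (Fin n) C(X, ℂ)) (F : Finset ι) :
    (Fin n → ℓ²(ι, ℂ)) →L[ℂ] (Fin n → ℓ²(ι, ℂ)) :=
  ContinuousLinearMap.pi fun k => ∑ l,
    (cutoff F ∘L (diagOp pt₁ (M k l) - diagOp pt₀ (M k l))) ∘L ContinuousLinearMap.proj l

theorem truncatedDifference_apply (pt₀ pt₁ : ι → Option X)
    (M : Matrix (Fin n) (Fin n) C(X, ℂ)) (F : Finset ι) (v : Fin n → ℓ²(ι, ℂ)) (k : Fin n) :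
    truncatedDifference pt₀ pt₁ M F v k =
      ∑ l, (cutoff F ∘L (diagOp pt₁ (M k l) - diagOp pt₀ (M k l))) (v l) := by
  simp [truncatedDifference]

open Classical in
theorem cutoff_comp_diagOp_sub_apply (pt₀ pt₁ : ι → Option X) (f : C(X, ℂ)) (F : Finset ι)
    (v : ℓ²(ι, ℂ)) (i : ι) :
    (cutoff F ∘L (diagOp pt₁ f - diagOp pt₀ f)) v i =
      (if i ∈ F then 0 else evalOption f (pt₁ i) - evalOption f (pt₀ i)) * v i := by
  rw [ContinuousLinearMap.comp_apply, cutoff_apply, sub_apply, lp.coeFn_sub, Pi.sub_apply,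
    diagOp_apply, diagOp_apply]
  split_ifs
  · rw [zero_mul]
  · rw [sub_mul]

theorem column_truncatedDifference_of_mem (pt₀ pt₁ : ι → Option X)
    (M : Matrix (Fin n) (Fin n) C(X, ℂ)) {F : Finset ι} (v : Fin n → ℓ²(ι, ℂ)) {i : ι}
    (hi : i ∈ F) : column i (truncatedDifference pt₀ pt₁ M F v) = 0 := by
  ext k
  rw [column_apply, truncatedDifference_apply, ← coordinate_apply, map_sum]
  refine Finset.sum_eq_zero fun l _ => ?_
  rw [coordinate_apply, cutoff_comp_diagOp_sub_apply, if_pos hi, zero_mul]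

theorem column_truncatedDifference_of_notMem (pt₀ pt₁ : ι → Option X)
    (M : Matrix (Fin n) (Fin n) C(X, ℂ)) {F : Finset ι} (v : Fin n → ℓ²(ι, ℂ)) {i : ι}
    (hi : i ∉ F) : column i (truncatedDifference pt₀ pt₁ M F v) =
      (evalOptionMatrix M (pt₁ i) - evalOptionMatrix M (pt₀ i)) *ᵥ column i v := by
  ext k
  rw [column_apply, truncatedDifference_apply, ← coordinate_apply, map_sum]
  refine Finset.sum_congr rfl fun l _ => ?_
  rw [coordinate_apply, cutoff_comp_diagOp_sub_apply, if_neg hi]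
  rfl

/-- The factor `n` comes from the maximum norm: each component is a sum of `n` terms of norm at most
`ε * ‖v‖`. -/
theorem norm_truncatedDifference_le {pt₀ pt₁ : ι → Option X}
    {M : Matrix (Fin n) (Fin n) C(X, ℂ)} {F : Finset ι} {ε : ℝ} (hε : 0 ≤ ε)
    (hF : ∀ i ∉ F, ∀ k l,
      ‖evalOption (M k l) (pt₁ i) - evalOption (M k l) (pt₀ i)‖ ≤ ε) :
    ‖truncatedDifference pt₀ pt₁ M F‖ ≤ n * ε := by
  refine ContinuousLinearMap.opNorm_le_bound _ (by positivity) fun v => ?_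
  refine (pi_norm_le_iff_of_nonneg (by positivity)).mpr fun k => ?_
  rw [truncatedDifference_apply]
  have hl : ∀ l ∈ Finset.univ,
      ‖(cutoff F ∘L (diagOp pt₁ (M k l) - diagOp pt₀ (M k l))) (v l)‖ ≤ ε * ‖v‖ := by
    intro l _
    classical
    have h := norm_le_of_apply_eq_mul hε (cutoff_comp_diagOp_sub_apply pt₀ pt₁ (M k l) F)
      fun i => by
        split_ifs with hi
        · simpa using hε
        · exact hF i hi k l
    exact (ContinuousLinearMap.le_of_opNorm_le _ h _).trans
      (mul_le_mul_of_nonneg_left (norm_le_pi_norm v l) hε)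
  refine (norm_sum_le_of_le _ hl).trans_eq ?_
  simp [mul_assoc]

/-- If the evaluations of `p` along `pt₀` and `pt₁` are close outside of the finite set `F`, then
the compression is Fredholm, and its index is the sum over `F` of the differences of the ranks. -/
theorem isFredholm_and_index_compression (pt₀ pt₁ : ι → Option X) (P : MatProj C(X, ℂ))
    (F : Finset ι) {ε : ℝ} (hε : 0 ≤ ε)
    (hF : ∀ i ∉ F, ∀ k l,
      ‖evalOption (P.p k l) (pt₁ i) - evalOption (P.p k l) (pt₀ i)‖ ≤ ε)
    (hsmall : ‖(2 * amplify (diagRep pt₀) P.p - 1 :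
      (Fin P.n → ℓ²(ι, ℂ)) →L[ℂ] (Fin P.n → ℓ²(ι, ℂ)))‖ * (P.n * ε) < 1) :
    (compression (diagRep pt₀) (diagRep pt₁) (ContinuousLinearMap.id ℂ _) P).IsFredholm ∧
    index (compression (diagRep pt₀) (diagRep pt₁) (ContinuousLinearMap.id ℂ _) P) =
      ∑ i ∈ F, (((evalOptionMatrix P.p (pt₁ i)).rank : ℤ) -
        ((evalOptionMatrix P.p (pt₀ i)).rank : ℤ)) := by
  have hP : P.p * P.p = P.p := P.isProj.isIdempotentElem
  set E₀ := amplify (diagRep pt₀) P.p with hE₀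
  set E₁ := amplify (diagRep pt₁) P.p with hE₁
  set D := truncatedDifference pt₀ pt₁ P.p F with hD
  -- The Neumann series inverts `u = 1 + (2E₀ - 1)D`. Truncating `D` makes `u` the identity on the
  -- coordinates in `F` and the fibrewise intertwiner elsewhere.
  have hnorm : ‖-((2 * E₀ - 1) * D)‖ < 1 := by
    rw [norm_neg]
    exact (norm_mul_le _ _).trans_lt ((mul_le_mul_of_nonneg_left
      (norm_truncatedDifference_le hε hF) (norm_nonneg _)).trans_lt hsmall)
  let u := Units.oneSub _ hnorm
  have hu : ∀ v, u.1 v = v + (2 * E₀ - 1) (D v) := fun v => by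
    simp only [u, Units.val_oneSub, sub_neg_eq_add]
    rfl
  have huinv : ∀ v, u.1 (u⁻¹.1 v) = v := fun v => by
    rw [← mul_apply_eq_comp, u.mul_inv]
    rfl
  have hinvu : ∀ v, u⁻¹.1 (u.1 v) = v := fun v => by
    rw [← mul_apply_eq_comp, u.inv_mul]
    rfl
  have hu_mem : ∀ v, ∀ i ∈ F, column i (u.1 v) = column i v := fun v i hi => by
    have h0 : column i (E₀ (D v)) = 0 := by
      rw [column_amplify, column_truncatedDifference_of_mem _ _ _ _ hi, Matrix.mulVec_zero]
    have h : (2 * E₀ - 1) (D v) = (2 : ℂ) • E₀ (D v) - D v := by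
      rw [two_smul, two_mul]
      rfl
    rw [hu, h, map_add, map_sub, map_smul, h0, column_truncatedDifference_of_mem _ _ _ _ hi]
    simp
  have hu_notMem : ∀ v, ∀ i ∉ F, column i (u.1 v) =
      (1 + (2 * evalOptionMatrix P.p (pt₀ i) - 1) *
        (evalOptionMatrix P.p (pt₁ i) - evalOptionMatrix P.p (pt₀ i))) *ᵥ column i v := by
    intro v i hi
    have h : (2 * E₀ - 1) (D v) = E₀ (D v) + E₀ (D v) - D v := by
      rw [two_mul]
      rfl
    rw [hu, h, map_add, map_sub, map_add, column_amplify,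
      column_truncatedDifference_of_notMem _ _ _ _ hi, Matrix.add_mulVec, Matrix.one_mulVec,
      ← Matrix.mulVec_mulVec, Matrix.sub_mulVec (2 * _), two_mul, Matrix.add_mulVec,
      Matrix.one_mulVec]
  have hint₁ := fun i => intertwiner_mul (evalOptionMatrix_isIdempotent hP (pt₀ i))
    (evalOptionMatrix_isIdempotent hP (pt₁ i))
  have hint₀ := fun i => mul_intertwiner (o := evalOptionMatrix P.p (pt₁ i))
    (evalOptionMatrix_isIdempotent hP (pt₀ i))
  set T := compression (diagRep pt₀) (diagRep pt₁) (ContinuousLinearMap.id ℂ _) P with hTdef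
  have hcol : ∀ v i, column i (T v).1 =
      evalOptionMatrix P.p (pt₀ i) *ᵥ (evalOptionMatrix P.p (pt₁ i) *ᵥ column i v.1) := by
    intro v i
    have h : (T v).1 = E₀ (E₁ v.1) := rfl
    rw [h, column_amplify, column_amplify]
  -- On this subspace `T v = E₀ E₁ v = u E₁ v = u v`: the intertwining relation is needed only
  -- outside `F`.
  have hTu : ∀ v ∈ rangeOff pt₁ P.p F, (T v).1 = u.1 v.1 := fun v hv => ext_column fun i => by
    rw [hcol]
    by_cases hi : i ∈ F
    · rw [hu_mem _ i hi, mem_rangeOff.mp hv i hi, Matrix.mulVec_zero, Matrix.mulVec_zero]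
    · rw [hu_notMem _ i hi, ← (mem_range_amplify_iff pt₁ hP v.1).mp v.2 i,
        Matrix.mulVec_mulVec, Matrix.mulVec_mulVec, Matrix.mulVec_mulVec, Matrix.mul_assoc,
        evalOptionMatrix_isIdempotent hP, hint₁]
  -- As `u` is injective, the equation is tested after applying `u`: outside `F` intertwining turns
  -- `u E₁ u⁻¹ w` into `E₀ w = w`, and on `F` both sides vanish.
  have hfix : ∀ w ∈ rangeOff pt₀ P.p F, E₁ (u⁻¹.1 w.1) = u⁻¹.1 w.1 := by
    intro w hw
    rw [← hinvu (E₁ (u⁻¹.1 w.1))]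
    congr 1
    refine ext_column fun i => ?_
    by_cases hi : i ∈ F
    · rw [hu_mem _ i hi, column_amplify, ← hu_mem _ i hi, huinv, mem_rangeOff.mp hw i hi,
        Matrix.mulVec_zero]
    · rw [hu_notMem _ i hi, column_amplify, Matrix.mulVec_mulVec, hint₁, ← hint₀,
        ← Matrix.mulVec_mulVec, ← hu_notMem _ i hi, huinv,
        (mem_range_amplify_iff pt₀ hP w.1).mp w.2 i]
  let R : E₀.range →L[ℂ] E₁.range :=
    (E₁ ∘L u⁻¹.1 ∘L E₀.range.subtypeL).codRestrict _ fun _ => ⟨_, rfl⟩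
  have hRval : ∀ w, (R w).1 = E₁ (u⁻¹.1 w.1) := fun _ => rfl
  have hR : Set.MapsTo R (rangeOff pt₀ P.p F) (rangeOff pt₁ P.p F) := fun w hw => by
    refine mem_rangeOff.mpr fun i hi => ?_
    rw [hRval, hfix w hw, ← hu_mem _ i hi, huinv, mem_rangeOff.mp hw i hi]
  have hT : Set.MapsTo T (rangeOff pt₁ P.p F) (rangeOff pt₀ P.p F) := fun v hv => by
    refine mem_rangeOff.mpr fun i hi => ?_
    rw [hTu v hv, hu_mem _ i hi, mem_rangeOff.mp hv i hi]
  have := finite_quotient_rangeOff pt₀ hP F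
  have := finite_quotient_rangeOff pt₁ hP F
  have hmain := isFredholm_and_index_of_restrict T R (isClosed_rangeOff pt₁ P.p F)
    (isClosed_rangeOff pt₀ P.p F) hT hR
    (fun v hv => Subtype.ext (by
      rw [hRval, hTu v hv, hinvu]
      exact ext_column fun i => (column_amplify pt₁ P.p v.1 i).trans
        ((mem_range_amplify_iff pt₁ hP v.1).mp v.2 i)))
    (fun w hw => Subtype.ext (by rw [hTu _ (hR hw), hRval, hfix w hw, huinv]))
  rw [finrank_quotient_rangeOff pt₀ hP, finrank_quotient_rangeOff pt₁ hP] at hmain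
  refine ⟨hmain.1, hmain.2.trans ?_⟩
  rw [Finset.sum_sub_distrib]
  push_cast
  rfl

end Compression

/-! ### Block operators and the Fredholm module of a unitary -/

section Block

variable {H₀ H₁ : Type*} [NormedAddCommGroup H₀] [InnerProductSpace ℂ H₀]
  [NormedAddCommGroup H₁] [InnerProductSpace ℂ H₁]

theorem blockOp_mul (a a' : H₀ →L[ℂ] H₀) (b b' : H₁ →L[ℂ] H₀) (c c' : H₀ →L[ℂ] H₁)
    (d d' : H₁ →L[ℂ] H₁) :
    blockOp a b c d * blockOp a' b' c' d' =
      blockOp (a ∘L a' + b ∘L c') (a ∘L b' + b ∘L d')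
        (c ∘L a' + d ∘L c') (c ∘L b' + d ∘L d') := by
  ext x : 1
  simp only [mul_apply_eq_comp, blockOp_apply, add_apply, ContinuousLinearMap.comp_apply,
    WithLp.toLp_fst, WithLp.toLp_snd, map_add]
  congr 2 <;> abel

theorem blockOp_sub (a a' : H₀ →L[ℂ] H₀) (b b' : H₁ →L[ℂ] H₀) (c c' : H₀ →L[ℂ] H₁)
    (d d' : H₁ →L[ℂ] H₁) :
    blockOp a b c d - blockOp a' b' c' d' = blockOp (a - a') (b - b') (c - c') (d - d') := by
  ext x : 1
  simp only [sub_apply, blockOp_apply, ← WithLp.toLp_sub, Prod.mk_sub_mk]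
  congr 2 <;> abel

theorem blockOp_neg (a : H₀ →L[ℂ] H₀) (b : H₁ →L[ℂ] H₀) (c : H₀ →L[ℂ] H₁)
    (d : H₁ →L[ℂ] H₁) : -blockOp a b c d = blockOp (-a) (-b) (-c) (-d) := by
  ext x : 1
  simp only [neg_apply, blockOp_apply, ← WithLp.toLp_neg, Prod.neg_mk, neg_add]

theorem blockOp_one : blockOp (ContinuousLinearMap.id ℂ H₀) 0 0 (ContinuousLinearMap.id ℂ H₁) =
    1 := by
  ext x : 1
  simp [blockOp_apply]
  rfl

theorem isCompactOperator_blockOp_offDiagonal {b : H₁ →L[ℂ] H₀} {c : H₀ →L[ℂ] H₁}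
    (hb : IsCompactOperator b) (hc : IsCompactOperator c) :
    IsCompactOperator (blockOp 0 b c 0) := by
  let e := (WithLp.prodContinuousLinearEquiv 2 ℂ H₀ H₁)
  have h : ⇑(blockOp 0 b c 0) =
      (⇑(e.symm.toContinuousLinearMap ∘L ContinuousLinearMap.inl ℂ H₀ H₁) ∘
        (b ∘ (ContinuousLinearMap.snd ℂ H₀ H₁ ∘L e.toContinuousLinearMap))) +
      (⇑(e.symm.toContinuousLinearMap ∘L ContinuousLinearMap.inr ℂ H₀ H₁) ∘
        (c ∘ (ContinuousLinearMap.fst ℂ H₀ H₁ ∘L e.toContinuousLinearMap))) := by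
    funext x
    simp only [blockOp_apply, Pi.add_apply, Function.comp_apply, ContinuousLinearMap.comp_apply,
      zero_apply, zero_add, add_zero]
    change WithLp.toLp 2 (b x.snd, c x.fst) =
      WithLp.toLp 2 (b x.snd, 0) + WithLp.toLp 2 (0, c x.fst)
    rw [← WithLp.toLp_add, Prod.mk_add_mk, add_zero, zero_add]
  rw [h]
  exact ((hb.comp_clm _).clm_comp _).add ((hc.comp_clm _).clm_comp _)

variable [CompleteSpace H₀] [CompleteSpace H₁]

theorem star_blockOp (a : H₀ →L[ℂ] H₀) (b : H₁ →L[ℂ] H₀) (c : H₀ →L[ℂ] H₁)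
    (d : H₁ →L[ℂ] H₁) :
    star (blockOp a b c d) = blockOp (ContinuousLinearMap.adjoint a)
      (ContinuousLinearMap.adjoint c) (ContinuousLinearMap.adjoint b)
      (ContinuousLinearMap.adjoint d) := by
  symm
  rw [ContinuousLinearMap.star_eq_adjoint, ContinuousLinearMap.eq_adjoint_iff]
  intro x y
  simp only [blockOp_apply, WithLp.prod_inner_apply, inner_add_left, inner_add_right,
    ContinuousLinearMap.adjoint_inner_left]
  exact add_add_add_comm _ _ _ _

/-- A unitary that intertwines two representations modulo compact operators defines an even
Fredholm module. -/
theorem isEvenFredholmModule_of_unitary {A : Type*} [CStarAlgebra A]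
    (ρ₀ : A →⋆ₙₐ[ℂ] (H₀ →L[ℂ] H₀)) (ρ₁ : A →⋆ₙₐ[ℂ] (H₁ →L[ℂ] H₁)) (G : H₁ →L[ℂ] H₀)
    (hG : G ∘L ContinuousLinearMap.adjoint G = ContinuousLinearMap.id ℂ H₀)
    (hG' : ContinuousLinearMap.adjoint G ∘L G = ContinuousLinearMap.id ℂ H₁)
    (h₁ : ∀ a, IsCompactOperator (G ∘L ρ₁ a - ρ₀ a ∘L G))
    (h₂ : ∀ a, IsCompactOperator
      (ContinuousLinearMap.adjoint G ∘L ρ₀ a - ρ₁ a ∘L ContinuousLinearMap.adjoint G)) :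
    IsEvenFredholmModule (sumRep ρ₀ ρ₁) (offDiagonal G) (grading H₀ H₁) where
  compact_adjoint := by
    rw [offDiagonal, star_blockOp, ContinuousLinearMap.adjoint_adjoint, map_zero, map_zero,
      sub_self]
    exact isCompactOperator_zero
  compact_square := by
    rw [offDiagonal, blockOp_mul, hG, hG']
    simp only [ContinuousLinearMap.comp_zero, zero_add, add_zero, ContinuousLinearMap.zero_comp]
    rw [blockOp_one, sub_self]
    exact isCompactOperator_zero
  compact_commutator a := by
    change IsCompactOperator (offDiagonal G * blockOp (ρ₀ a) 0 0 (ρ₁ a) -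
      blockOp (ρ₀ a) 0 0 (ρ₁ a) * offDiagonal G :)
    rw [offDiagonal, blockOp_mul, blockOp_mul, blockOp_sub]
    simp only [ContinuousLinearMap.comp_zero, zero_add, add_zero, ContinuousLinearMap.zero_comp,
      sub_self]
    exact isCompactOperator_blockOp_offDiagonal (h₁ a) (h₂ a)
  grading_selfAdjoint := by
    rw [grading, star_blockOp, map_zero, map_zero, map_neg, ContinuousLinearMap.adjoint_id,
      ContinuousLinearMap.adjoint_id]
  grading_square := by
    rw [grading, blockOp_mul, ← blockOp_one]
    simp
  grading_anticomm := by
    rw [grading, offDiagonal, blockOp_mul, blockOp_mul, blockOp_neg]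
    simp
  grading_comm a := by
    change grading H₀ H₁ * blockOp (ρ₀ a) 0 0 (ρ₁ a) = blockOp (ρ₀ a) 0 0 (ρ₁ a) * grading H₀ H₁
    rw [grading, blockOp_mul, blockOp_mul]
    simp

end Block

/-! ### The module of `Φ` and its index -/

section PhiModule

variable {S : Scale} (Φ : C(ZS S, ℤ) →+ ℤ)

/-- The labels `(y, j)` with `y < m`. -/
def labelsBelow (m : ℕ) : Finset (Label Φ) := (Finset.range m).sigma fun _ => Finset.univ

theorem notMem_labelsBelow {m : ℕ} {i : Label Φ} (h : i ∉ labelsBelow Φ m) : m ≤ i.1 := by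
  by_contra hlt
  exact h (Finset.mem_sigma.mpr ⟨Finset.mem_range.mpr (not_le.mp hlt), Finset.mem_univ _⟩)

theorem norm_evalOption_oddPoint_sub_evPoint (f : C(ZS S, ℂ)) (i : Label Φ) :
    ‖evalOption f (oddPoint Φ i) - evalOption f (evPoint Φ i)‖ =
      ‖evalOption f (some ((i.1 : ℕ) : ZS S)) - evalOption f (gamPoint i.1)‖ := by
  rw [oddPoint, evPoint]
  split_ifs
  · rfl
  · exact norm_sub_rev _ _

theorem exists_forall_notMem_labelsBelow (f : C(ZS S, ℂ)) {ε : ℝ} (hε : 0 < ε) :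
    ∃ N, ∀ M, N ≤ M → ∀ i ∉ labelsBelow Φ (S.s M),
      ‖evalOption f (oddPoint Φ i) - evalOption f (evPoint Φ i)‖ ≤ ε := by
  obtain ⟨N, hN⟩ := exists_gamPoint_dist_lt S f hε
  refine ⟨N, fun M hM i hi => ?_⟩
  rw [norm_evalOption_oddPoint_sub_evPoint]
  exact (hN i.1 ((S.s_mono hM).trans (notMem_labelsBelow Φ hi))).le

theorem isCompactOperator_rhoOdd_sub_rhoEv (f : C(ZS S, ℂ)) :
    IsCompactOperator (rhoOdd Φ f - rhoEv Φ f : Hodd Φ →L[ℂ] Hev Φ) := by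
  refine isCompactOperator_of_apply_eq_mul
    (c := fun i => evalOption f (oddPoint Φ i) - evalOption f (evPoint Φ i)) (fun v i => ?_)
    fun ε hε => ?_
  · rw [sub_mul]
    rfl
  · obtain ⟨N, hN⟩ := exists_forall_notMem_labelsBelow Φ f hε
    exact ⟨_, hN N le_rfl⟩

theorem rank_evalOptionMatrix (P : MatProj C(ZS S, ℂ)) (x : Option (ZS S)) :
    ((evalOptionMatrix P.p x).rank : ℤ) = x.elim 0 P.rankFn := by
  cases x with
  | none =>
    have h : evalOptionMatrix P.p none = 0 := rfl
    rw [h, Matrix.rank_zero]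
    rfl
  | some x => rfl

/-- Each `y` occurs `|φ_(y)|` times, and for negative `φ_(y)` the roles of `y` and `γ(y)` are
exchanged, so it contributes `φ_(y)` times the increment of the rank in either case. -/
theorem sum_labelsBelow_rank (P : MatProj C(ZS S, ℂ)) (m : ℕ) :
    ∑ i ∈ labelsBelow Φ m, (((evalOptionMatrix P.p (oddPoint Φ i)).rank : ℤ) -
        ((evalOptionMatrix P.p (evPoint Φ i)).rank : ℤ)) =
      Φ (∑ y ∈ Finset.range m, increment P.rankFn y • generator S y) := by
  rw [map_sum, labelsBelow, Finset.sum_sigma]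
  refine Finset.sum_congr rfl fun y _ => ?_
  rw [map_zsmul]
  change _ = increment P.rankFn y • coeff Φ y
  simp only [rank_evalOptionMatrix, oddPoint, evPoint]
  rw [Finset.sum_const, Finset.card_univ, Fintype.card_fin, smul_eq_mul, nsmul_eq_mul, increment]
  split_ifs with h
  · rw [Int.natCast_natAbs, abs_of_pos h, Option.elim_some, mul_comm]
  · rw [Int.natCast_natAbs, abs_of_nonpos (not_lt.mp h), Option.elim_some]
    ring

theorem isFredholm_and_index_phiModule (P : MatProj C(ZS S, ℂ)) :
    (compression (rhoEv Φ) (rhoOdd Φ) (swapL Φ) P).IsFredholm ∧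
      index (compression (rhoEv Φ) (rhoOdd Φ) (swapL Φ) P) = Φ P.rankFn := by
  obtain ⟨ε, hε, hsmall⟩ : ∃ ε : ℝ, 0 < ε ∧
      ‖(2 * amplify (diagRep (evPoint Φ)) P.p - 1 :
        (Fin P.n → Hev Φ) →L[ℂ] (Fin P.n → Hev Φ))‖ * (P.n * ε) < 1 := by
    set C := ‖(2 * amplify (diagRep (evPoint Φ)) P.p - 1 :
        (Fin P.n → Hev Φ) →L[ℂ] (Fin P.n → Hev Φ))‖ * P.n with hC
    have hC0 : 0 ≤ C := by positivity
    -- This choice gives `C * ε = C / (C + 1) < 1`, including when `C = 0`.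
    refine ⟨(C + 1)⁻¹, by positivity, ?_⟩
    rw [← mul_assoc, ← hC, mul_inv_lt_iff₀ (by positivity)]
    linarith
  have hent : ∀ kl : Fin P.n × Fin P.n, ∃ N, ∀ M, N ≤ M → ∀ i ∉ labelsBelow Φ (S.s M),
      ‖evalOption (P.p kl.1 kl.2) (oddPoint Φ i) -
        evalOption (P.p kl.1 kl.2) (evPoint Φ i)‖ ≤ ε :=
    fun kl => exists_forall_notMem_labelsBelow Φ _ hε
  choose N hN using hent
  obtain ⟨N', hN'⟩ := exists_eq_sum_generator S P.rankFn
  -- A level that serves all matrix entries of `p` and the expansion of the rank function at once.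
  set M := max (Finset.univ.sup N) N' with hM
  have h := isFredholm_and_index_compression (evPoint Φ) (oddPoint Φ) P
    (labelsBelow Φ (S.s M)) hε.le
    (fun i hi k l => hN (k, l) M ((Finset.le_sup (Finset.mem_univ (k, l))).trans
      (le_max_left _ _)) i hi) hsmall
  rw [sum_labelsBelow_rank, ← hN' M (le_max_right _ _)] at h
  exact h

end PhiModule

end Odometer

/-- The triple `(H_ev ⊕ H_odd, ρ_ev ⊕ ρ_odd, F)` built from `Φ` is an even Fredholm module over
`C(ℤ_S)`, and its index pairing with `K₀(C(ℤ_S)) ≅ C(ℤ_S, ℤ)` is `Φ`. -/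
theorem mainTheorem8 (S : Odometer.Scale) (Φ : C(Odometer.ZS S, ℤ) →+ ℤ) :
    Odometer.IsEvenFredholmModule
      (Odometer.sumRep (Odometer.rhoEv Φ) (Odometer.rhoOdd Φ))
      (Odometer.offDiagonal (Odometer.swapL Φ))
      (Odometer.grading (Odometer.Hev Φ) (Odometer.Hodd Φ)) ∧
    Odometer.IsIndexPairing (Odometer.rhoEv Φ) (Odometer.rhoOdd Φ) (Odometer.swapL Φ)
      (Φ.comp Odometer.K0.dim) := by
  -- With `G` the identity, both off-diagonal blocks of the commutator are `±(ρ_odd(f) - ρ_ev(f))`.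
  have hG : Odometer.swapL Φ = ContinuousLinearMap.id ℂ (Odometer.Hev Φ) := rfl
  refine ⟨Odometer.isEvenFredholmModule_of_unitary _ _ _ ?_ ?_ (fun f => ?_) fun f => ?_,
    fun P => ?_⟩
  · rw [hG, ContinuousLinearMap.adjoint_id]
    rfl
  · rw [hG, ContinuousLinearMap.adjoint_id]
    rfl
  · exact Odometer.isCompactOperator_rhoOdd_sub_rhoEv Φ f
  · rw [hG, ContinuousLinearMap.adjoint_id]
    have h := (Odometer.isCompactOperator_rhoOdd_sub_rhoEv Φ f).neg
    have hneg : -(Odometer.rhoOdd Φ f - Odometer.rhoEv Φ f) =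
      Odometer.rhoEv Φ f - Odometer.rhoOdd Φ f := neg_sub _ _
    rw [← FunLike.coe_neg, hneg] at h
    exact h
  · have h := Odometer.isFredholm_and_index_phiModule Φ P
    refine ⟨h.1, ?_⟩
    rw [h.2]
    simp [Odometer.K0.dim, Odometer.K0.mk]
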